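/- Let $\Omega\subset\mathbb C^N$ be a domain (a non-empty connected open set), let $\mathcal O(\Omega)$ be the space of holomorphic functions $\Omega\to\mathbb C$ with the topology of locally uniform convergence, and for a holomorphic map $\varphi:\Omega\to\Omega$ let $C_\varphi:\mathcal O(\Omega)\to\mathcal O(\Omega)$, $C_\varphi f=f\circ\varphi$. Write $\varphi^{[n]}$ for the $n$-th iterate of $\varphi$. For a strictly increasing sequence $(n_l)_l$ of natural numbers, $C_\varphi$ is called hypercyclic with respect to $(n_l)_l$ if there is $f\in\mathcal O(\Omega)$ such that $\{f\circ\varphi^{[n_l]}:l\in\mathbb N\}$ is dense in $\mathcal O(\Omega)$, and hypercyclic if this holds for $n_l=l$. It is called hereditarily hypercyclic if it is hypercyclic with respect to every strictly increasing sequence of natural numbers. The domain $\Omega$ is called taut if every sequence of holomorphic maps $f_n:\mathbb D\to\Omega$ from the unit disc either is compactly divergent (for all compact $K\subset\mathbb D$, $L\subset\Omega$ one has $f_n(K)\cap L=\varnothing$ for all large $n$) or has a subsequence converging locally uniformly to a holomorphic map $\mathbb D\to\Omega$. The domain $\Omega$ is called hypercyclic if it is pseudoconvex and, for every holomorphic $\varphi:\Omega\to\Omega$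 and every strictly increasing sequence $(n_l)_l$ of natural numbers, the following three conditions together imply that $C_\varphi$ is hypercyclic with respect to $(n_l)_l$: (1) $\varphi$ is injective; (2) $\varphi(\Omega)$ is Runge with respect to $\Omega$, i.e. every holomorphic function on $\varphi(\Omega)$ can be approximated locally uniformly on $\varphi(\Omega)$ by functions from $\mathcal O(\Omega)$; (3) $(\varphi^{[n_l]})_l$ is run-away, i.e. for all compact $K,L\subset\Omega$ there is $l$ with $\varphi^{[n_l]}(K)\cap L=\varnothing$. **Theorem.** Let $\Omega\subset\mathbb C^N$ be a hypercyclic taut domain and let $\varphi:\Omega\to\Omega$ be a holomorphic map. If the operator $C_\varphi$ is hypercyclic, then it is hereditarily hypercyclic. -/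

import Mathlib

namespace Hypercyclicity

/-! ### Universality and hypercyclicity -/

/-- `x` is a universal element for `(T n)`: its orbit `{T n x : n}` is dense. -/
def IsUniversalElement {X : Type*} [TopologicalSpace X] (T : ℕ → X → X) (x : X) : Prop :=
  Dense (Set.range fun n => T n x)

/-- The sequence `(T n)` has a universal element. -/
def IsUniversal {X : Type*} [TopologicalSpace X] (T : ℕ → X → X) : Prop :=
  ∃ x : X, IsUniversalElement T x

/-- Each subsequence of `(T n)` is universal. -/
def IsHereditarilyUniversal {X : Type*} [TopologicalSpace X] (T : ℕ → X → X) : Prop :=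
  ∀ k : ℕ → ℕ, StrictMono k → IsUniversal fun l => T (k l)

/-- `T` is hypercyclic with respect to the sequence `(n l)`. -/
def IsHypercyclicWrt {X : Type*} [TopologicalSpace X] (T : X → X) (n : ℕ → ℕ) : Prop :=
  IsUniversal fun l => T^[n l]

/-- `T` is hereditarily hypercyclic with respect to the sequence `(n l)`. -/
def IsHereditarilyHypercyclicWrt {X : Type*} [TopologicalSpace X] (T : X → X) (n : ℕ → ℕ) :
    Prop :=
  IsHereditarilyUniversal fun l => T^[n l]

/-- `T` is hypercyclic: with respect to the full sequence of iterates. -/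
def IsHypercyclic {X : Type*} [TopologicalSpace X] (T : X → X) : Prop :=
  IsHypercyclicWrt T fun l => l

/-- `T` is hereditarily hypercyclic: with respect to the full sequence of iterates. -/
def IsHereditarilyHypercyclic {X : Type*} [TopologicalSpace X] (T : X → X) : Prop :=
  IsHereditarilyHypercyclicWrt T fun l => l

/-! ### Holomorphic functions and composition operators

A holomorphic map on an open set `Ω` is given by a function on the whole space which is complex
differentiable on `Ω`; its values off `Ω` play no role. -/

/-- The space `𝒪(Ω)` of holomorphic functions `Ω → ℂ`, with the compact-open topology (the
topology induced from the space `C(Ω, ℂ)`). -/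
abbrev HolSpace {N : ℕ} (Ω : Set (EuclideanSpace ℂ (Fin N))) : Type :=
  {f : C(Ω, ℂ) // ∃ F : EuclideanSpace ℂ (Fin N) → ℂ,
    DifferentiableOn ℂ F Ω ∧ ∀ z : Ω, f z = F z}

/-- The composition operator `f ↦ f ∘ φ` on `𝒪(Ω)`, for a holomorphic self-map `φ` of `Ω`. -/
noncomputable def compOp {N : ℕ} (Ω : Set (EuclideanSpace ℂ (Fin N)))
    (φ : EuclideanSpace ℂ (Fin N) → EuclideanSpace ℂ (Fin N))
    (hφ : DifferentiableOn ℂ φ Ω) (hmaps : Set.MapsTo φ Ω Ω) (f : HolSpace Ω) : HolSpace Ω :=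
  ⟨f.1.comp ⟨hmaps.restrict φ Ω Ω, hφ.continuousOn.mapsToRestrict hmaps⟩, by
    obtain ⟨F, hF, hfF⟩ := f.2
    exact ⟨F ∘ φ, hF.comp hφ hmaps, fun z => hfF _⟩⟩

theorem continuous_compOp {N : ℕ} (Ω : Set (EuclideanSpace ℂ (Fin N)))
    (φ : EuclideanSpace ℂ (Fin N) → EuclideanSpace ℂ (Fin N))
    (hφ : DifferentiableOn ℂ φ Ω) (hmaps : Set.MapsTo φ Ω Ω) :
    Continuous (compOp Ω φ hφ hmaps) :=
  ((ContinuousMap.continuous_precomp _).comp continuous_subtype_val).subtype_mk _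

/-! ### Domains -/

/-- `u` is a continuous (real-valued) plurisubharmonic function on the open set `Ω`: on every
closed complex disc `{z + ζ w : |ζ| ≤ 1}` contained in `Ω` it satisfies the sub-mean value
inequality. -/
def IsContinuousPSH {N : ℕ} (u : EuclideanSpace ℂ (Fin N) → ℝ)
    (Ω : Set (EuclideanSpace ℂ (Fin N))) : Prop :=
  ContinuousOn u Ω ∧
    ∀ z w : EuclideanSpace ℂ (Fin N),
      (∀ ζ ∈ Metric.closedBall (0 : ℂ) 1, z + ζ • w ∈ Ω) →
        u z ≤ Real.circleAverage (fun ζ : ℂ => u (z + ζ • w)) 0 1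

/-- A pseudoconvex domain in `ℂ^N`: a non-empty connected open set which has a continuous
plurisubharmonic exhaustion function. -/
structure IsPseudoconvexDomain {N : ℕ} (Ω : Set (EuclideanSpace ℂ (Fin N))) : Prop where
  isOpen : IsOpen Ω
  isConnected : IsConnected Ω
  exists_exhaustion : ∃ u : EuclideanSpace ℂ (Fin N) → ℝ,
    IsContinuousPSH u Ω ∧ ∀ c : ℝ, IsCompact {z ∈ Ω | u z ≤ c}

/-- `U ⊆ Ω` is Runge with respect to `Ω`: every holomorphic function on `U` is a locally uniform
limit on `U` of holomorphic functions on `Ω`. This is used only for open `U` that are images of a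
pseudoconvex domain under an injective holomorphic map, hence are pseudoconvex domains. -/
def IsRungeIn {N : ℕ} (U Ω : Set (EuclideanSpace ℂ (Fin N))) : Prop :=
  U ⊆ Ω ∧ ∀ h : EuclideanSpace ℂ (Fin N) → ℂ, DifferentiableOn ℂ h U →
    ∀ K ⊆ U, IsCompact K → ∀ ε > (0 : ℝ),
      ∃ g : EuclideanSpace ℂ (Fin N) → ℂ, DifferentiableOn ℂ g Ω ∧ ∀ z ∈ K, ‖g z - h z‖ < ε

/-- The sequence of maps `f n : Ω → Ω'` is run-away. -/
def IsRunAway {E F : Type*} [TopologicalSpace E] [TopologicalSpace F] (f : ℕ → E → F)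
    (Ω : Set E) (Ω' : Set F) : Prop :=
  ∀ K ⊆ Ω, IsCompact K → ∀ L ⊆ Ω', IsCompact L → ∃ n, Disjoint (f n '' K) L

/-- The sequence of maps `f n : Ω → Ω'` is compactly divergent. -/
def IsCompactlyDivergent {E F : Type*} [TopologicalSpace E] [TopologicalSpace F] (f : ℕ → E → F)
    (Ω : Set E) (Ω' : Set F) : Prop :=
  ∀ K ⊆ Ω, IsCompact K → ∀ L ⊆ Ω', IsCompact L → ∃ n₀, ∀ n ≥ n₀, Disjoint (f n '' K) L

/-- `Ω` is taut: every sequence of holomorphic maps from the unit disc to `Ω` is compactly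
divergent or has a subsequence converging locally uniformly to a holomorphic map from the unit
disc to `Ω`. -/
def IsTaut {N : ℕ} (Ω : Set (EuclideanSpace ℂ (Fin N))) : Prop :=
  ∀ f : ℕ → ℂ → EuclideanSpace ℂ (Fin N),
    (∀ n, DifferentiableOn ℂ (f n) (Metric.ball 0 1) ∧
      Set.MapsTo (f n) (Metric.ball 0 1) Ω) →
    IsCompactlyDivergent f (Metric.ball 0 1) Ω ∨
      ∃ k : ℕ → ℕ, StrictMono k ∧ ∃ g : ℂ → EuclideanSpace ℂ (Fin N),
        DifferentiableOn ℂ g (Metric.ball 0 1) ∧ Set.MapsTo g (Metric.ball 0 1) Ω ∧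
        TendstoLocallyUniformlyOn (fun j => f (k j)) g Filter.atTop (Metric.ball 0 1)

/-- A hypercyclic domain: a pseudoconvex domain `Ω` such that, for every holomorphic self-map `φ`
of `Ω` and every increasing sequence `(n l)`, the conditions "`φ` is injective", "`φ(Ω)` is Runge
in `Ω`" and "`(φ^[n l])` is run-away" suffice for hypercyclicity of `C_φ` with respect to
`(n l)`. -/
structure IsHypercyclicDomain {N : ℕ} (Ω : Set (EuclideanSpace ℂ (Fin N))) : Prop where
  isPseudoconvexDomain : IsPseudoconvexDomain Ω
  sufficient : ∀ (φ : EuclideanSpace ℂ (Fin N) → EuclideanSpace ℂ (Fin N))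
    (hφ : DifferentiableOn ℂ φ Ω) (hmaps : Set.MapsTo φ Ω Ω) (n : ℕ → ℕ), StrictMono n →
    Set.InjOn φ Ω → IsRungeIn (φ '' Ω) Ω → IsRunAway (fun l => φ^[n l]) Ω Ω →
    IsHypercyclicWrt (compOp Ω φ hφ hmaps) n

end Hypercyclicity

/-! The three sufficient conditions of a hypercyclic domain are shown to be necessary, the last one
in a form that passes to subsequences. Hypercyclicity makes the functions `H ∘ φ` dense
(`exists_approx_comp`). Approximating coordinates forces `φ` and its differentials to be injective,
so `φ⁻¹` is continuous on `φ '' Ω`, and pulling functions back along `φ` gives the Runge property.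
Tautness upgrades run-away to compact divergence. If the iterates did not diverge, normality would
give a recurrent point whose whole orbit lies in a compact subset of `Ω`. A universal function is
bounded there, so it cannot approximate large constants at that point. Compact divergence is
inherited by every subsequence, hence so is run-away. -/

namespace Hypercyclicity

open Filter Topology Metric Set

/-! ### Holomorphic maps between finite-dimensional spaces -/

section Holomorphic

variable {E F : Type*} [NormedAddCommGroup E] [NormedSpace ℂ E]
  [NormedAddCommGroup F] [NormedSpace ℂ F]

/-- Cauchy's estimate for a directional derivative. -/
theorem norm_fderiv_apply_le_of_disc {f : E → F} {Ω : Set E} (hΩ : IsOpen Ω)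
    (hf : DifferentiableOn ℂ f Ω) {a w : E} {C : ℝ}
    (hw : ∀ ζ ∈ closedBall (0 : ℂ) 1, a + ζ • w ∈ Ω)
    (hC : ∀ ζ ∈ closedBall (0 : ℂ) 1, ‖f (a + ζ • w)‖ ≤ C) :
    ‖fderiv ℂ f a w‖ ≤ C := by
  have ha : a ∈ Ω := by simpa using hw 0 (by simp)
  have hline : ∀ ζ : ℂ, HasDerivAt (fun ζ : ℂ => a + ζ • w) w ζ := fun ζ => by
    simpa using ((hasDerivAt_id ζ).smul_const w).const_add a
  have hd : DifferentiableOn ℂ (fun ζ : ℂ => f (a + ζ • w)) (closedBall 0 1) :=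
    hf.comp (fun ζ _ => (hline ζ).differentiableAt.differentiableWithinAt) hw
  have hderiv : deriv (fun ζ : ℂ => f (a + ζ • w)) 0 = fderiv ℂ f a w := by
    have h0 : HasFDerivAt f (fderiv ℂ f a) (a + (0 : ℂ) • w) := by
      simpa using (hf.differentiableAt (hΩ.mem_nhds ha)).hasFDerivAt
    exact (h0.comp_hasDerivAt (0 : ℂ) (hline 0)).deriv
  have := Complex.norm_deriv_le_of_forall_mem_sphere_norm_le (c := (0 : ℂ)) one_pos
    (DifferentiableOn.diffContOnCl (by rwa [closure_ball _ one_ne_zero]))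
    (fun ζ hζ => hC ζ (sphere_subset_closedBall hζ))
  simpa [hderiv] using this

/-- Cauchy's estimate is applied to `f (z + (y - a)) - f z`, which is uniformly small for `y` near
`a`. Finite dimension reduces continuity to one direction `v` at a time. -/
theorem continuousAt_fderiv_of_differentiableOn [FiniteDimensional ℂ E] {f : E → F} {Ω : Set E}
    (hΩ : IsOpen Ω) (hf : DifferentiableOn ℂ f Ω) {a : E} (ha : a ∈ Ω) :
    ContinuousAt (fderiv ℂ f) a := by
  have : ProperSpace E := FiniteDimensional.proper ℂ E
  obtain ⟨R, hR, hball⟩ := Metric.nhds_basis_closedBall.mem_iff.1 (hΩ.mem_nhds ha)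
  have huc : UniformContinuousOn f (closedBall a R) :=
    (isCompact_closedBall a R).uniformContinuousOn_of_continuous (hf.continuousOn.mono hball)
  rw [continuousAt_clm_apply]
  intro v
  set t : ℝ := R / (2 * (‖v‖ + 1)) with ht
  have htpos : 0 < t := by positivity
  have htv : ‖(t : ℂ) • v‖ < R / 2 := by
    rw [norm_smul, Complex.norm_real, Real.norm_of_nonneg htpos.le, ht, div_mul_eq_mul_div,
      div_lt_div_iff₀ (by positivity) two_pos]
    nlinarith [norm_nonneg v]
  rw [Metric.continuousAt_iff]
  intro ε hε
  obtain ⟨δ, hδ, hfδ⟩ := Metric.uniformContinuousOn_iff.1 huc (t * (ε / 2)) (by positivity)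
  refine ⟨min δ (R / 2), lt_min hδ (half_pos hR), fun {y} hy => ?_⟩
  have hyδ : ‖y - a‖ < δ := by rw [← dist_eq_norm]; exact hy.trans_le (min_le_left _ _)
  have hyR : ‖y - a‖ < R / 2 := by rw [← dist_eq_norm]; exact hy.trans_le (min_le_right _ _)
  have hshift : ∀ z ∈ ball a (R / 2), z + (y - a) ∈ ball a R := fun z hz => by
    rw [mem_ball_iff_norm] at hz ⊢
    calc ‖z + (y - a) - a‖ = ‖(z - a) + (y - a)‖ := by congr 1; abel
      _ ≤ ‖z - a‖ + ‖y - a‖ := norm_add_le _ _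
      _ < R := by linarith
  have hsub : ball a R ⊆ Ω := ball_subset_closedBall.trans hball
  have hsub' : ball a (R / 2) ⊆ ball a R := ball_subset_ball (by linarith)
  have hd1 : DifferentiableOn ℂ (fun z => f (z + (y - a))) (ball a (R / 2)) :=
    hf.comp (differentiableOn_id.add_const _) fun z hz => hsub (hshift z hz)
  have hd2 : DifferentiableOn ℂ f (ball a (R / 2)) := hf.mono (hsub'.trans hsub)
  have hw : ∀ ζ ∈ closedBall (0 : ℂ) 1, a + ζ • ((t : ℂ) • v) ∈ ball a (R / 2) := by
    intro ζ hζ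
    rw [mem_ball_iff_norm, add_sub_cancel_left, norm_smul]
    have : ‖ζ‖ ≤ 1 := by simpa using hζ
    nlinarith [norm_nonneg ((t : ℂ) • v)]
  have key := norm_fderiv_apply_le_of_disc isOpen_ball (hd1.sub hd2) (C := t * (ε / 2)) hw
    (fun ζ hζ => by
      have h := hw ζ hζ
      have := hfδ _ (ball_subset_closedBall (hshift _ h)) _ (ball_subset_closedBall (hsub' h))
        (by rw [dist_eq_norm, add_sub_cancel_left]; exact hyδ)
      rw [dist_eq_norm] at this
      exact this.le)
  have haR : ball a (R / 2) ∈ 𝓝 a := ball_mem_nhds a (half_pos hR)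
  rw [fderiv_sub (hd1.differentiableAt haR) (hd2.differentiableAt haR), fderiv_comp_add_right,
    add_sub_cancel, map_smul, norm_smul, Complex.norm_real, Real.norm_of_nonneg htpos.le] at key
  have := le_of_mul_le_mul_left key htpos
  rw [dist_eq_norm]
  rw [sub_apply] at this
  linarith

theorem hasStrictFDerivAt_of_differentiableOn [FiniteDimensional ℂ E] {f : E → F} {Ω : Set E}
    (hΩ : IsOpen Ω) (hf : DifferentiableOn ℂ f Ω) {a : E} (ha : a ∈ Ω) :
    HasStrictFDerivAt f (fderiv ℂ f a) a :=
  hasStrictFDerivAt_of_hasFDerivAt_of_continuousAt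
    ((hΩ.mem_nhds ha |> eventually_mem_set.2).mono fun _ hy =>
      (hf.differentiableAt (hΩ.mem_nhds hy)).hasFDerivAt)
    (continuousAt_fderiv_of_differentiableOn hΩ hf ha)

/-- A holomorphic map with injective differentials is open. -/
theorem isOpenMap_domRestrict_of_injective_fderiv [FiniteDimensional ℂ E] {f : E → E} {Ω : Set E}
    (hΩ : IsOpen Ω) (hf : DifferentiableOn ℂ f Ω)
    (hinj : ∀ a ∈ Ω, Function.Injective (fderiv ℂ f a)) :
    IsOpenMap (Ω.domRestrict f) := by
  have : CompleteSpace E := FiniteDimensional.complete ℂ E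
  rw [isOpenMap_iff_nhds_le]
  rintro ⟨a, ha⟩
  have hsurj : Function.Surjective (fderiv ℂ f a : E →ₗ[ℂ] E) :=
    LinearMap.injective_iff_surjective.1 (hinj a ha)
  have hmap := (hasStrictFDerivAt_of_differentiableOn hΩ hf ha).map_nhds_eq_of_surj
    (LinearMap.range_eq_top.2 hsurj)
  change 𝓝 (f a) ≤ map (f ∘ Subtype.val) (𝓝 (⟨a, ha⟩ : Ω))
  rw [← Filter.map_map, map_nhds_subtype_coe_eq_nhds ha (hΩ.mem_nhds ha), hmap]

end Holomorphic

/-! ### Consequences of hypercyclicity -/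

section CompositionOperator

variable {N : ℕ} {Ω : Set (EuclideanSpace ℂ (Fin N))}
  {φ : EuclideanSpace ℂ (Fin N) → EuclideanSpace ℂ (Fin N)}

theorem differentiableOn_iterate (hφ : DifferentiableOn ℂ φ Ω) (hmaps : MapsTo φ Ω Ω) (n : ℕ) :
    DifferentiableOn ℂ φ^[n] Ω := by
  induction n with
  | zero => exact differentiableOn_id
  | succ n ih => exact ih.comp hφ hmaps

theorem compOp_iterate_apply (hφ : DifferentiableOn ℂ φ Ω) (hmaps : MapsTo φ Ω Ω)
    (f : HolSpace Ω) (n : ℕ) (z : Ω) :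
    ((compOp Ω φ hφ hmaps)^[n] f).1 z = f.1 ⟨φ^[n] z, hmaps.iterate n z.2⟩ := by
  induction n generalizing f with
  | zero => rfl
  | succ n ih =>
    rw [Function.iterate_succ_apply, ih]
    change f.1 _ = f.1 _
    congr 1
    exact Subtype.ext (Function.iterate_succ_apply' φ n z).symm

/-- A hypercyclic composition operator has a function whose compositions with the iterates of the
symbol approximate every holomorphic function uniformly on compact sets. -/
theorem exists_approx_iterate {hφ : DifferentiableOn ℂ φ Ω} {hmaps : MapsTo φ Ω Ω}
    (h : IsHypercyclic (compOp Ω φ hφ hmaps)) :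
    ∃ F : EuclideanSpace ℂ (Fin N) → ℂ, DifferentiableOn ℂ F Ω ∧
      ∀ G : EuclideanSpace ℂ (Fin N) → ℂ, DifferentiableOn ℂ G Ω → ∀ K ⊆ Ω, IsCompact K →
        ∀ ε > (0 : ℝ), ∃ n, ∀ z ∈ K, ‖F (φ^[n] z) - G z‖ < ε := by
  obtain ⟨f, hf⟩ := h
  obtain ⟨F, hF, hfF⟩ := f.2
  refine ⟨F, hF, fun G hG K hK hKc ε hε => ?_⟩
  let g : HolSpace Ω := ⟨⟨fun z : Ω => G z, hG.continuousOn.domRestrict⟩, G, hG, fun _ => rfl⟩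
  have hKc' : IsCompact ((↑) ⁻¹' K : Set Ω) := by
    rw [Subtype.isCompact_iff, Subtype.image_preimage_coe, inter_eq_right.2 hK]
    exact hKc
  have hopen : IsOpen {u : HolSpace Ω | MapsTo (u.1 - g.1) ((↑) ⁻¹' K : Set Ω) (ball 0 ε)} :=
    (ContinuousMap.isOpen_setOfPred_mapsTo hKc' isOpen_ball).preimage
      (continuous_subtype_val.sub continuous_const)
  obtain ⟨_, hu, n, rfl⟩ := Dense.inter_open_nonempty hf _ hopen ⟨g, fun z _ => by simp [hε]⟩
  refine ⟨n, fun z hz => ?_⟩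
  have := hu (show (⟨z, hK hz⟩ : Ω) ∈ ((↑) ⁻¹' K : Set Ω) from hz)
  rw [mem_ball_zero_iff, ContinuousMap.sub_apply] at this
  have h1 := compOp_iterate_apply hφ hmaps f n ⟨z, hK hz⟩
  rw [hfF] at h1
  rwa [h1] at this

/-- A hypercyclic composition operator has dense range. -/
theorem exists_approx_comp {hφ : DifferentiableOn ℂ φ Ω} {hmaps : MapsTo φ Ω Ω}
    (h : IsHypercyclic (compOp Ω φ hφ hmaps)) {G : EuclideanSpace ℂ (Fin N) → ℂ}
    (hG : DifferentiableOn ℂ G Ω) {K : Set (EuclideanSpace ℂ (Fin N))} (hK : K ⊆ Ω)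
    (hKc : IsCompact K) {ε : ℝ} (hε : 0 < ε) :
    ∃ H : EuclideanSpace ℂ (Fin N) → ℂ, DifferentiableOn ℂ H Ω ∧
      ∀ z ∈ K, ‖H (φ z) - G z‖ < ε := by
  rcases K.eq_empty_or_nonempty with rfl | ⟨z₀, hz₀⟩
  · exact ⟨G, hG, by simp⟩
  obtain ⟨F, hF, happ⟩ := exists_approx_iterate h
  -- With this shift the error at `z₀` is exactly `ε` when `n = 0`, so the approximating iterate
  -- must factor through `φ`.
  set c : ℂ := F z₀ - G z₀ + ε with hc
  obtain ⟨n, hn⟩ := happ (fun z => G z + c) (hG.add_const c) K hK hKc ε hε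
  cases n with
  | zero =>
    have := hn z₀ hz₀
    have heq : F (φ^[0] z₀) - (G z₀ + c) = -(ε : ℂ) := by
      rw [hc, Function.iterate_zero_apply]; ring
    rw [heq, norm_neg, Complex.norm_real, Real.norm_of_nonneg hε.le] at this
    exact absurd this (lt_irrefl _)
  | succ n =>
    refine ⟨fun z => F (φ^[n] z) - c, (hF.comp (differentiableOn_iterate hφ hmaps n)
      (hmaps.iterate n)).sub_const c, fun z hz => ?_⟩
    have := hn z hz
    rwa [Function.iterate_succ_apply, add_comm, ← sub_sub] at this

theorem differentiable_coord (i : Fin N) :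
    Differentiable ℂ fun z : EuclideanSpace ℂ (Fin N) => z i :=
  (EuclideanSpace.proj (𝕜 := ℂ) i).differentiable

/-- No `H ∘ φ` separates two points with the same image, yet such functions approximate each
coordinate. -/
theorem injOn_of_isHypercyclic {hφ : DifferentiableOn ℂ φ Ω} {hmaps : MapsTo φ Ω Ω}
    (h : IsHypercyclic (compOp Ω φ hφ hmaps)) : InjOn φ Ω := by
  intro a ha b hb hab
  ext i
  by_contra hne
  have hpos : 0 < ‖a i - b i‖ := norm_pos_iff.2 (sub_ne_zero.2 hne)
  obtain ⟨H, -, hH⟩ := exists_approx_comp h (differentiable_coord i).differentiableOn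
    (K := {a, b}) (insert_subset ha (singleton_subset_iff.2 hb)) (by simp) (half_pos hpos)
  have h1 := hH a (by simp)
  have h2 := hH b (by simp)
  rw [hab] at h1
  have : ‖a i - b i‖ ≤ ‖H (φ b) - b i‖ + ‖H (φ b) - a i‖ := by
    refine le_trans (le_of_eq ?_) (norm_sub_le _ _)
    congr 1; ring
  linarith

/-- Along a kernel vector every `H ∘ φ` has derivative zero. By Cauchy's estimate, uniform
approximation of a coordinate also approximates its derivative. -/
theorem injective_fderiv_of_isHypercyclic (hΩ : IsOpen Ω) {hφ : DifferentiableOn ℂ φ Ω}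
    {hmaps : MapsTo φ Ω Ω} (h : IsHypercyclic (compOp Ω φ hφ hmaps))
    {a : EuclideanSpace ℂ (Fin N)} (ha : a ∈ Ω) : Function.Injective (fderiv ℂ φ a) := by
  rw [injective_iff_map_eq_zero]
  intro v hv
  by_contra hv0
  obtain ⟨R, hR, hball⟩ := Metric.nhds_basis_closedBall.mem_iff.1 (hΩ.mem_nhds ha)
  have hvn : 0 < ‖v‖ := norm_pos_iff.2 hv0
  set w : EuclideanSpace ℂ (Fin N) := ((R / ‖v‖ : ℝ) : ℂ) • v with hw
  have hwn : ‖w‖ = R := by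
    rw [hw, norm_smul, Complex.norm_real, Real.norm_of_nonneg (by positivity),
      div_mul_cancel₀ _ hvn.ne']
  have hw0 : w ≠ 0 := norm_pos_iff.1 (hwn ▸ hR)
  have hφw : fderiv ℂ φ a w = 0 := by rw [hw, map_smul, hv, smul_zero]
  obtain ⟨i, hi⟩ : ∃ i, w i ≠ 0 := by
    by_contra! hall
    exact hw0 (by ext i; simpa using hall i)
  have hpos : 0 < ‖w i‖ := norm_pos_iff.2 hi
  have hdisc : ∀ ζ ∈ closedBall (0 : ℂ) 1, a + ζ • w ∈ closedBall a R := by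
    intro ζ hζ
    rw [mem_closedBall_iff_norm, add_sub_cancel_left, norm_smul, hwn]
    have : ‖ζ‖ ≤ 1 := by simpa using hζ
    nlinarith
  obtain ⟨H, hHd, hH⟩ := exists_approx_comp h (differentiable_coord i).differentiableOn
    hball (isCompact_closedBall a R) (half_pos hpos)
  have hd1 : DifferentiableOn ℂ (fun z => H (φ z)) Ω := hHd.comp hφ hmaps
  have key := norm_fderiv_apply_le_of_disc hΩ
    (hd1.sub (differentiable_coord i).differentiableOn)
    (fun ζ hζ => hball (hdisc ζ hζ)) (fun ζ hζ => (hH _ (hdisc ζ hζ)).le)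
  have hΩa := hΩ.mem_nhds ha
  have e1 : fderiv ℂ (fun z => H (φ z)) a w = 0 := by
    have hc : HasFDerivAt (fun z => H (φ z)) _ a :=
      ((hHd.differentiableAt (hΩ.mem_nhds (hmaps ha))).hasFDerivAt).comp a
        (hφ.differentiableAt hΩa).hasFDerivAt
    rw [hc.fderiv, ContinuousLinearMap.comp_apply, hφw, map_zero]
  have e2 : fderiv ℂ (fun z : EuclideanSpace ℂ (Fin N) => z i) a w = w i := by
    have hc : HasFDerivAt (fun z : EuclideanSpace ℂ (Fin N) => z i) _ a :=
      (EuclideanSpace.proj (𝕜 := ℂ) i).hasFDerivAt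
    rw [hc.fderiv]; rfl
  rw [fderiv_sub (hd1.differentiableAt hΩa) (differentiable_coord i).differentiableAt,
    sub_apply, e1, e2, zero_sub, norm_neg] at key
  linarith

theorem isRungeIn_image_of_isHypercyclic (hΩ : IsOpen Ω) {hφ : DifferentiableOn ℂ φ Ω}
    {hmaps : MapsTo φ Ω Ω} (h : IsHypercyclic (compOp Ω φ hφ hmaps)) : IsRungeIn (φ '' Ω) Ω := by
  refine ⟨hmaps.image_subset, fun u hu K hK hKc ε hε => ?_⟩
  have hleft : LeftInvOn (Function.invFunOn φ Ω) φ Ω := (injOn_of_isHypercyclic h).leftInvOn_invFunOn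
  have hcont : ContinuousOn (Function.invFunOn φ Ω) (φ '' Ω) :=
    (isOpenMap_domRestrict_of_injective_fderiv hΩ hφ fun _ =>
      injective_fderiv_of_isHypercyclic hΩ h).continuousOn_image_of_leftInvOn hleft
  have hinv : ∀ z ∈ K, Function.invFunOn φ Ω z ∈ Ω ∧ φ (Function.invFunOn φ Ω z) = z :=
    fun z hz => ⟨Function.invFunOn_mem (hK hz), Function.invFunOn_eq (hK hz)⟩
  -- `u ∘ φ` is approximated by `H ∘ φ` on the compact preimage of `K`; then `H` approximates `u` on
  -- `K`.
  obtain ⟨H, hHd, hH⟩ := exists_approx_comp h (hu.comp hφ (mapsTo_image φ Ω))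
    (K := Function.invFunOn φ Ω '' K) (image_subset_iff.2 fun z hz => (hinv z hz).1)
    (hKc.image_of_continuousOn (hcont.mono hK)) hε
  refine ⟨H, hHd, fun z hz => ?_⟩
  have := hH _ (mem_image_of_mem _ hz)
  rwa [Function.comp_apply, (hinv z hz).2] at this

/-- No orbit of the symbol of a hypercyclic composition operator is relatively compact. -/
theorem not_forall_iterate_mem_of_isHypercyclic {hφ : DifferentiableOn ℂ φ Ω}
    {hmaps : MapsTo φ Ω Ω} (h : IsHypercyclic (compOp Ω φ hφ hmaps))
    {C : Set (EuclideanSpace ℂ (Fin N))} (hC : C ⊆ Ω) (hCc : IsCompact C)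
    (a : EuclideanSpace ℂ (Fin N)) : ¬ ∀ n, φ^[n] a ∈ C := by
  intro hmem
  obtain ⟨F, hF, happ⟩ := exists_approx_iterate h
  obtain ⟨M, hM⟩ := hCc.exists_bound_of_continuousOn (hF.continuousOn.mono hC)
  obtain ⟨n, hn⟩ := happ (fun _ => ((|M| + 1 : ℝ) : ℂ)) (differentiableOn_const _) {a}
    (singleton_subset_iff.2 (hC (hmem 0))) isCompact_singleton 1 one_pos
  have h1 := hn a rfl
  have h2 := hM _ (hmem n)
  have h3 := norm_sub_norm_le ((|M| + 1 : ℝ) : ℂ) (F (φ^[n] a))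
  rw [norm_sub_rev, Complex.norm_real, Real.norm_of_nonneg (by positivity)] at h3
  linarith [le_abs_self M]

end CompositionOperator

/-! ### Iteration on taut domains -/

section Taut

variable {N : ℕ} {Ω : Set (EuclideanSpace ℂ (Fin N))}
  {φ : EuclideanSpace ℂ (Fin N) → EuclideanSpace ℂ (Fin N)}

/-- Tautness only concerns discs, so `x₀` and `x n` are joined by a disc in `Ω` on which they have
parameters `0` and `ζ n → 0`. The limit on discs then takes the same value along both. -/
theorem IsTaut.exists_subseq_tendsto (htaut : IsTaut Ω) (hΩ : IsOpen Ω)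
    {g : ℕ → EuclideanSpace ℂ (Fin N) → EuclideanSpace ℂ (Fin N)}
    (hg : ∀ n, DifferentiableOn ℂ (g n) Ω) (hgm : ∀ n, MapsTo (g n) Ω Ω)
    {x : ℕ → EuclideanSpace ℂ (Fin N)} {x₀ y : EuclideanSpace ℂ (Fin N)} (hx₀ : x₀ ∈ Ω)
    (hy : y ∈ Ω) (hx : Tendsto x atTop (𝓝 x₀))
    (hgx : Tendsto (fun n => g n (x n)) atTop (𝓝 y)) :
    ∃ k : ℕ → ℕ, StrictMono k ∧ Tendsto (fun j => g (k j) x₀) atTop (𝓝 y) := by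
  obtain ⟨r, hr, hball⟩ := Metric.isOpen_iff.1 hΩ x₀ hx₀
  obtain ⟨s, hs, hsball⟩ := Metric.nhds_basis_closedBall.mem_iff.1 (hΩ.mem_nhds hy)
  let ζ : ℕ → ℂ := fun n => ((‖x n - x₀‖ / r : ℝ) : ℂ)
  let w : ℕ → EuclideanSpace ℂ (Fin N) := fun n => ((r / ‖x n - x₀‖ : ℝ) : ℂ) • (x n - x₀)
  have hwn : ∀ n, ‖w n‖ ≤ r := fun n => by
    simp only [w, norm_smul, Complex.norm_real]
    rw [Real.norm_of_nonneg (by positivity)]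
    rcases eq_or_ne ‖x n - x₀‖ 0 with h | h
    · rw [h, mul_zero]; exact hr.le
    · rw [div_mul_cancel₀ _ h]
  have hζw : ∀ n, x₀ + ζ n • w n = x n := fun n => by
    rcases eq_or_ne (x n) x₀ with h | h
    · simp [ζ, w, h]
    · have h' : ‖x n - x₀‖ ≠ 0 := norm_ne_zero_iff.2 (sub_ne_zero.2 h)
      simp only [ζ, w]
      rw [smul_smul, ← Complex.ofReal_mul, div_mul_div_cancel₀ hr.ne', div_self h',
        Complex.ofReal_one, one_smul, add_sub_cancel]
  have hζ : Tendsto ζ atTop (𝓝 0) := by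
    have h1 : Tendsto (fun n => ‖x n - x₀‖ / r) atTop (𝓝 0) := by
      simpa using ((hx.sub_const x₀).norm).div_const r
    have h2 := (Complex.continuous_ofReal.tendsto 0).comp h1
    rwa [Complex.ofReal_zero] at h2
  have hdisc : ∀ n, MapsTo (fun z : ℂ => x₀ + z • w n) (ball 0 1) Ω := fun n z hz => by
    refine hball ?_
    rw [mem_ball_iff_norm, add_sub_cancel_left, norm_smul]
    have hz1 : ‖z‖ < 1 := by simpa using hz
    rcases (norm_nonneg (w n)).eq_or_lt with h | h
    · rw [← h, mul_zero]; exact hr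
    · exact (mul_lt_of_lt_one_left h hz1).trans_le (hwn n)
  rcases htaut (fun n z => g n (x₀ + z • w n)) (fun n =>
      ⟨(hg n).comp ((differentiable_id.smul_const (w n)).const_add x₀).differentiableOn (hdisc n),
        (hgm n).comp (hdisc n)⟩) with hdiv | ⟨k, hk, G, hG, -, hlim⟩
  -- Divergence is impossible: the values at `ζ n` are `g n (x n)`, which stay near `y`.
  · obtain ⟨n₀, hn₀⟩ := hdiv (closedBall 0 (1 / 2)) (closedBall_subset_ball (by norm_num))
      (isCompact_closedBall _ _) (closedBall y s) hsball (isCompact_closedBall _ _)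
    obtain ⟨n, hn, hζn, hgn⟩ := ((eventually_ge_atTop n₀).and
      ((hζ.eventually (closedBall_mem_nhds 0 (by norm_num : (0 : ℝ) < 1 / 2))).and
        (hgx.eventually (closedBall_mem_nhds y hs)))).exists
    refine absurd hgn (disjoint_left.1 (hn₀ n hn) ⟨ζ n, hζn, ?_⟩)
    simp only [hζw]
  · refine ⟨k, hk, ?_⟩
    have h0 : (0 : ℂ) ∈ ball (0 : ℂ) 1 := by simp
    have hlim0 : Tendsto (fun j => g (k j) x₀) atTop (𝓝 (G 0)) := by
      simpa using hlim.tendsto_at h0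
    have hlimζ : Tendsto (fun j => g (k j) (x₀ + ζ (k j) • w (k j))) atTop (𝓝 (G 0)) :=
      hlim.tendsto_comp (hG.continuousOn 0 h0) h0 (by
        rw [isOpen_ball.nhdsWithin_eq h0]
        exact hζ.comp hk.tendsto_atTop)
    simp only [hζw] at hlimζ
    rwa [tendsto_nhds_unique hlimζ (hgx.comp hk.tendsto_atTop)] at hlim0

/-- Sequences of self-maps of a taut domain are equicontinuous where they do not diverge. -/
theorem IsTaut.tendsto_of_tendsto (htaut : IsTaut Ω) (hΩ : IsOpen Ω)
    {g : ℕ → EuclideanSpace ℂ (Fin N) → EuclideanSpace ℂ (Fin N)}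
    (hg : ∀ n, DifferentiableOn ℂ (g n) Ω) (hgm : ∀ n, MapsTo (g n) Ω Ω)
    {x : ℕ → EuclideanSpace ℂ (Fin N)} {x₀ y : EuclideanSpace ℂ (Fin N)} (hx₀ : x₀ ∈ Ω)
    (hy : y ∈ Ω) (hx : Tendsto x atTop (𝓝 x₀))
    (hgx : Tendsto (fun n => g n (x n)) atTop (𝓝 y)) :
    Tendsto (fun n => g n x₀) atTop (𝓝 y) := by
  refine tendsto_of_subseq_tendsto fun ns hns => ?_
  obtain ⟨k, -, hk⟩ := htaut.exists_subseq_tendsto hΩ (fun n => hg (ns n)) (fun n => hgm (ns n))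
    hx₀ hy (hx.comp hns) (hgx.comp hns)
  exact ⟨k, hk⟩

/-- If the iterates of a self-map of a taut domain do not diverge, the map has a recurrent
point. -/
theorem IsTaut.exists_recurrent (htaut : IsTaut Ω) (hΩ : IsOpen Ω)
    (hφ : DifferentiableOn ℂ φ Ω) (hmaps : MapsTo φ Ω Ω)
    (hdiv : ¬ IsCompactlyDivergent (fun n => φ^[n]) Ω Ω) :
    ∃ a ∈ Ω, ∃ m : ℕ → ℕ, Tendsto m atTop atTop ∧
      Tendsto (fun k => φ^[m k] a) atTop (𝓝 a) := by
  simp only [IsCompactlyDivergent] at hdiv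
  push Not at hdiv
  obtain ⟨K, hK, hKc, L, hL, hLc, hKL⟩ := hdiv
  obtain ⟨p, hp, hpKL⟩ := extraction_of_frequently_atTop (frequently_atTop.2 hKL)
  have : ∀ k, ∃ z ∈ K, φ^[p k] z ∈ L := fun k => by
    obtain ⟨_, ⟨z, hz, rfl⟩, hzL⟩ := not_disjoint_iff.1 (hpKL k)
    exact ⟨z, hz, hzL⟩
  choose z hzK hzL using this
  obtain ⟨⟨z₀, a⟩, ⟨hz₀, ha⟩, q, hq, hlim⟩ := (hKc.prod hLc).tendsto_subseq
    (x := fun k => (z k, φ^[p k] (z k))) fun k => ⟨hzK k, hzL k⟩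
  rw [nhds_prod_eq, tendsto_prod_iff'] at hlim
  have hpq : StrictMono (p ∘ q) := hp.comp hq
  have h1 : Tendsto (fun k => φ^[(p ∘ q) k] z₀) atTop (𝓝 a) :=
    htaut.tendsto_of_tendsto hΩ (fun k => differentiableOn_iterate hφ hmaps _)
      (fun k => hmaps.iterate _) (hK hz₀) (hL ha) hlim.1 hlim.2
  -- The gaps between times `k` and `2 * k` of the sequence are at least `k`. The corresponding
  -- iterates carry points tending to `a` to points tending to `a`, so they also bring `a` itself
  -- back.
  have hle : ∀ k, k + (p ∘ q) k ≤ (p ∘ q) (2 * k) := fun k => by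
    have := hpq.add_le_nat k k
    rwa [← two_mul] at this
  refine ⟨a, hL ha, fun k => (p ∘ q) (2 * k) - (p ∘ q) k,
    tendsto_atTop_mono (fun k => Nat.le_sub_of_add_le (hle k)) tendsto_id,
    htaut.tendsto_of_tendsto hΩ (fun k => differentiableOn_iterate hφ hmaps _)
      (fun k => hmaps.iterate _) (hL ha) (hL ha) h1 ?_⟩
  have h2 : Tendsto (fun k => φ^[(p ∘ q) (2 * k)] z₀) atTop (𝓝 a) :=
    h1.comp (tendsto_id.const_mul_atTop' two_pos)
  refine h2.congr fun k => ?_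
  rw [← Function.iterate_add_apply, Nat.sub_add_cancel (le_trans (Nat.le_add_left _ _) (hle k))]

/-- Every point in the orbit closure of a recurrent point `a` returns to each neighbourhood
of `a`. -/
theorem IsTaut.exists_return (htaut : IsTaut Ω) (hΩ : IsOpen Ω)
    (hφ : DifferentiableOn ℂ φ Ω) (hmaps : MapsTo φ Ω Ω) {a x : EuclideanSpace ℂ (Fin N)}
    (ha : a ∈ Ω) {m : ℕ → ℕ} (hm : Tendsto m atTop atTop)
    (hma : Tendsto (fun k => φ^[m k] a) atTop (𝓝 a)) (hx : x ∈ Ω)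
    (hxcl : x ∈ closure (range fun n => φ^[n] a)) {U : Set (EuclideanSpace ℂ (Fin N))}
    (hU : U ∈ 𝓝 a) : ∃ n, 1 ≤ n ∧ φ^[n] x ∈ U := by
  obtain ⟨u, hu, hux⟩ := mem_closure_iff_seq_limit.1 hxcl
  choose p hp using hu
  have : ∀ j, ∃ k ≥ j, p j + 1 ≤ m k := fun j => by
    obtain ⟨k, hk1, hk2⟩ :=
      ((eventually_ge_atTop j).and (hm.eventually_ge_atTop (p j + 1))).exists
    exact ⟨k, hk1, hk2⟩
  choose k hkj hk using this
  -- The iterate of order `m (k j) - p j` carries `φ^[p j] a`, near `x`, to `φ^[m (k j)] a`, near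
  -- `a`.
  have hlim : Tendsto (fun j => φ^[m (k j) - p j] x) atTop (𝓝 a) := by
    refine htaut.tendsto_of_tendsto hΩ (fun j => differentiableOn_iterate hφ hmaps _)
      (fun j => hmaps.iterate _) hx ha hux ?_
    refine (hma.comp (tendsto_atTop_mono hkj tendsto_id)).congr fun j => ?_
    rw [← hp j, ← Function.iterate_add_apply, Nat.sub_add_cancel (by have := hk j; omega)]
    rfl
  obtain ⟨j, hj⟩ := (hlim.eventually hU).exists
  exact ⟨_, by have := hk j; omega, hj⟩

/-- Recurrent points of self-maps of taut domains have relatively compact orbits. -/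
theorem IsTaut.exists_isCompact_orbit (htaut : IsTaut Ω) (hΩ : IsOpen Ω)
    (hφ : DifferentiableOn ℂ φ Ω) (hmaps : MapsTo φ Ω Ω) {a : EuclideanSpace ℂ (Fin N)}
    (ha : a ∈ Ω) {m : ℕ → ℕ} (hm : Tendsto m atTop atTop)
    (hma : Tendsto (fun k => φ^[m k] a) atTop (𝓝 a)) :
    ∃ C ⊆ Ω, IsCompact C ∧ ∀ n, φ^[n] a ∈ C := by
  obtain ⟨r, hr, hball⟩ := Metric.nhds_basis_closedBall.mem_iff.1 (hΩ.mem_nhds ha)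
  have hcont : ∀ n, ContinuousOn φ^[n] Ω := fun n =>
    (differentiableOn_iterate hφ hmaps n).continuousOn
  set X := closedBall a r ∩ closure (range fun n => φ^[n] a) with hX
  have hXc : IsCompact X := (isCompact_closedBall a r).inter_right isClosed_closure
  have hXΩ : X ⊆ Ω := inter_subset_left.trans hball
  obtain ⟨t, ht⟩ := hXc.elim_finite_subcover (fun n : ℕ => Ω ∩ φ^[n + 1] ⁻¹' ball a r)
    (fun n => (hcont (n + 1)).isOpen_inter_preimage hΩ isOpen_ball) fun x hx => by
      obtain ⟨n, hn, hnx⟩ := htaut.exists_return hΩ hφ hmaps ha hm hma (hXΩ hx) hx.2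
        (ball_mem_nhds a hr)
      obtain ⟨n, rfl⟩ := Nat.exists_eq_add_of_le' hn
      exact mem_iUnion.2 ⟨n, hXΩ hx, hnx⟩
  set T := t.sup id + 1 with hT
  have hreturn : ∀ x ∈ X, ∃ n, 1 ≤ n ∧ n ≤ T ∧ φ^[n] x ∈ ball a r := fun x hx => by
    obtain ⟨n, hn, -, hnx⟩ := mem_iUnion₂.1 (ht hx)
    exact ⟨n + 1, Nat.le_add_left _ _, Nat.succ_le_succ (Finset.le_sup (f := id) hn), hnx⟩
  -- Each time `n` lies at most `T` steps after a visit `s` to the ball. When the delay reaches `T`,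
  -- a later visit at `q + s` replaces `s`; `1 ≤ q` keeps the new delay `T + 1 - q` within `T`.
  have horbit : ∀ n, ∃ s i, s + i = n ∧ i ≤ T ∧ φ^[s] a ∈ ball a r := fun n => by
    induction n with
    | zero => exact ⟨0, 0, rfl, Nat.zero_le _, mem_ball_self hr⟩
    | succ n ih =>
      obtain ⟨s, i, hsi, hi, hs⟩ := ih
      rcases hi.lt_or_eq with h | h
      · exact ⟨s, i + 1, by omega, h, hs⟩
      · obtain ⟨q, hq1, hqT, hq⟩ := hreturn _
          ⟨ball_subset_closedBall hs, subset_closure (mem_range_self s)⟩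
        rw [← Function.iterate_add_apply] at hq
        exact ⟨q + s, T + 1 - q, by omega, by omega, hq⟩
  refine ⟨⋃ i ∈ Finset.range (T + 1), φ^[i] '' X, ?_, ?_, fun n => ?_⟩
  · exact iUnion₂_subset fun i _ => image_subset_iff.2 fun x hx => hmaps.iterate i (hXΩ hx)
  · exact (Finset.range (T + 1)).isCompact_biUnion fun i _ =>
      hXc.image_of_continuousOn ((hcont i).mono hXΩ)
  · obtain ⟨s, i, rfl, hi, hs⟩ := horbit n
    refine mem_iUnion₂.2 ⟨i, Finset.mem_range.2 (Nat.lt_succ_of_le hi), φ^[s] a,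
      ⟨ball_subset_closedBall hs, subset_closure (mem_range_self s)⟩, ?_⟩
    rw [← Function.iterate_add_apply, add_comm]

/-- On a taut domain, the iterates of the symbol of a hypercyclic composition operator are
compactly divergent. -/
theorem IsTaut.isCompactlyDivergent_of_isHypercyclic (htaut : IsTaut Ω) (hΩ : IsOpen Ω)
    {hφ : DifferentiableOn ℂ φ Ω} {hmaps : MapsTo φ Ω Ω}
    (h : IsHypercyclic (compOp Ω φ hφ hmaps)) :
    IsCompactlyDivergent (fun n => φ^[n]) Ω Ω := by
  by_contra hdiv
  obtain ⟨a, ha, m, hm, hma⟩ := htaut.exists_recurrent hΩ hφ hmaps hdiv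
  obtain ⟨C, hC, hCc, hmem⟩ := htaut.exists_isCompact_orbit hΩ hφ hmaps ha hm hma
  exact not_forall_iterate_mem_of_isHypercyclic h hC hCc a hmem

end Taut

end Hypercyclicity

theorem mainTheorem6 (N : ℕ) (Ω : Set (EuclideanSpace ℂ (Fin N)))
    (hΩ : Hypercyclicity.IsHypercyclicDomain Ω) (htaut : Hypercyclicity.IsTaut Ω)
    (φ : EuclideanSpace ℂ (Fin N) → EuclideanSpace ℂ (Fin N))
    (hφ : DifferentiableOn ℂ φ Ω) (hmaps : Set.MapsTo φ Ω Ω)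
    (hhyp : Hypercyclicity.IsHypercyclic (Hypercyclicity.compOp Ω φ hφ hmaps)) :
    Hypercyclicity.IsHereditarilyHypercyclic (Hypercyclicity.compOp Ω φ hφ hmaps) := by
  intro n hn
  have hopen := hΩ.isPseudoconvexDomain.isOpen
  refine hΩ.sufficient φ hφ hmaps n hn (Hypercyclicity.injOn_of_isHypercyclic hhyp)
    (Hypercyclicity.isRungeIn_image_of_isHypercyclic hopen hhyp) ?_
  intro K hK hKc L hL hLc
  obtain ⟨n₀, hn₀⟩ :=
    htaut.isCompactlyDivergent_of_isHypercyclic hopen hhyp K hK hKc L hL hLc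
  -- A strictly increasing sequence satisfies `n₀ ≤ n n₀`.
  exact ⟨n₀, hn₀ _ hn.le_apply⟩
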